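/- Let $n\ge 1$, let $\Omega\subset\mathbb{R}^n$ be non-empty, open and connected, and let $F:\Omega-\Omega\to\mathbb{C}$ be continuous and positive definite, i.e. $\sum_{i,j}\overline{c_i}c_jF(x_i-x_j)\ge 0$ for all finite systems $x_i\in\Omega$, $c_i\in\mathbb{C}$. Let $\mathscr{H}_F$ be the reproducing kernel Hilbert space of functions on $\Omega$ with kernel $(x,y)\mapsto F(x-y)$ (inner product linear in the second variable), with kernel functions $F_x=F(\cdot-x)$, $x\in\Omega$. For $\lambda\in\mathbb{R}^n$ write $e_\lambda(x)=e^{i\lambda\cdot x}$. Let $\mathrm{Ext}(F)$ be the set of finite positive Borel measures $\mu$ on $\mathbb{R}^n$ with $F(x)=\int e^{i\lambda\cdot x}\,d\mu(\lambda)$ for all $x\in\Omega-\Omega$. For $\varphi\in C_c(\Omega)$ put $F_\varphi(x)=\int_\Omega\varphi(y)F(x-y)\,dy$ and $\widehat\varphi(\lambda)=\int_\Omega e^{-i\lambda\cdot x}\varphi(x)\,dx$; for $f\in L^2(\mu)$ put $(f\,d\mu)^\vee(x)=\int e^{i\lambda\cdot x}f(\lambda)\,d\mu(\lambda)$, $x\in\mathbb{R}^n$.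 Assume $\mathrm{Ext}(F)\ne\emptyset$, let $\mu\in\mathrm{Ext}(F)$, and let $U$ be a corresponding strongly continuous unitary representation of $\mathbb{R}^n$ acting on $\mathscr{H}_F$: there is a vector $F_0\in\mathscr{H}_F$ (necessarily the kernel function at $0$ if $0\in\Omega$) such that $U(-x)F_0=F_x$ for all $x\in\Omega$ and $\langle F_0,U(t)F_0\rangle=\int e^{it\cdot\lambda}\,d\mu(\lambda)$ for all $t\in\mathbb{R}^n$. Then there is a unique projection-valued measure $P_U$ on the Borel sets of $\mathbb{R}^n$, acting on $\mathscr{H}_F$, with $U(t)=\int e^{it\cdot\lambda}P_U(d\lambda)$ for all $t\in\mathbb{R}^n$. For $\xi\in\mathscr{H}_F$ let $\mu_\xi(B)=\|P_U(B)\xi\|^2$. Then $\mu=\mu_{F_0}$, and: 1. $\mathscr{H}_F$ is the orthogonal sum $\mathscr{H}_F^{(atom)}\oplus\mathscr{H}_F^{(ac)}\oplus\mathscr{H}_F^{(sing)}$ of three closed subspaces, invariant under $U$ and $P_U$, which are characterized as follows: $\xi\in\mathscr{H}_F^{(atom)}$ iff $\mu_\xi$ is purely atomic; $\xi\in\mathscr{H}_F^{(ac)}$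 iff $\mu_\xi$ is absolutely continuous with respect to Lebesgue measure; $\xi\in\mathscr{H}_F^{(sing)}$ iff $\mu_\xi$ is continuous (has no atoms) and is singular with respect to Lebesgue measure. 2. (Atoms.) If $P_U(\{\lambda\})\ne 0$, then $e_\lambda|_\Omega\in\mathscr{H}_F$, and $P_U(\{\lambda\})\mathscr{H}_F=\mathbb{C}\,e_\lambda|_\Omega$ is one-dimensional. 3. (Absolutely continuous part.) Every $\xi\in\mathscr{H}_F^{(ac)}$ is a continuous function on $\Omega$. For all $\varphi\in C_c(\Omega)$, $F_\varphi\in\mathscr{H}_F$ and $\langle\xi,F_\varphi\rangle=\int_\Omega\overline{\xi(x)}\varphi(x)\,dx$. There is $f\in L^2(\mathbb{R}^n,\mu)$ such that $\int_\Omega\overline{\xi}\varphi\,dx=\int\overline{f}\,\widehat\varphi\,d\mu$ for all $\varphi\in C_c(\Omega)$ and $\xi=(f\,d\mu)^\vee|_\Omega$; thus $(f\,d\mu)^\vee$ is a $\mu$-extension of $\xi$. Every $\mu$-extension of $\xi$, i.e. every function $(g\,d\mu)^\vee$ with $g\in L^2(\mu)$ whose restriction to $\Omega$ is $\xi$, is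 continuous on $\mathbb{R}^n$ and tends to $0$ at infinity, i.e. lies in $C_0(\mathbb{R}^n)$. -/

import Mathlib

open MeasureTheory Filter Topology
open scoped InnerProductSpace ComplexConjugate Pointwise ENNReal

noncomputable section

namespace LocalPD

/-- The group `ℝⁿ`, with its Euclidean inner product and Lebesgue measure. -/
abbrev E (n : ℕ) : Type := EuclideanSpace ℝ (Fin n)

/-- The complex exponential `e_lam(x) = exp(i lam·x)`. -/
def expChar {n : ℕ} (lam x : E n) : ℂ := Complex.exp (Complex.I * ((inner ℝ lam x : ℝ) : ℂ))

/-- The Fourier transform `φ^(lam) = ∫ exp(-i lam·x) φ(x) dx`. -/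
def fourierHat {n : ℕ} (φ : E n → ℂ) (lam : E n) : ℂ := ∫ x, conj (expChar lam x) * φ x

/-- The inverse transform `(f dμ)^∨ (x) = ∫ exp(i lam·x) f(lam) dμ(lam)`. -/
def measureInvFourier {n : ℕ} (μ : Measure (E n)) (f : E n → ℂ) (x : E n) : ℂ :=
  ∫ lam, expChar lam x * f lam ∂μ

/-- `φ ∈ C_c(Ω)`, as a function on `ℝⁿ` vanishing outside a compact subset of `Ω`. -/
structure IsCc {n : ℕ} (Ω : Set (E n)) (φ : E n → ℂ) : Prop where
  continuous : Continuous φ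
  hasCompactSupport : HasCompactSupport φ
  tsupport_subset : tsupport φ ⊆ Ω

/-- The integral over `Ω` of `conj ξ * φ` with respect to Lebesgue measure. -/
def pairing {n : ℕ} {Ω : Set (E n)} (ξ : Ω → ℂ) (φ : E n → ℂ) : ℂ :=
  ∫ x : Ω, conj (ξ x) * φ x ∂((volume : Measure (E n)).comap Subtype.val)

open scoped ComplexOrder in
/-- A continuous positive definite function `F : Ω - Ω → ℂ`; it is carried by a function on
`ℝⁿ` of which only the values on `Ω - Ω` are ever used. -/
structure ContPosDef {n : ℕ} (Ω : Set (E n)) where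
  toFun : E n → ℂ
  continuousOn : ContinuousOn toFun (Ω - Ω)
  posDef : ∀ (m : ℕ) (x : Fin m → E n) (c : Fin m → ℂ), (∀ i, x i ∈ Ω) →
    0 ≤ ∑ i, ∑ j, conj (c i) * c j * toFun (x i - x j)

namespace ContPosDef

variable {n : ℕ} {Ω : Set (E n)}

/-- The kernel `(x, y) ↦ F(x - y)` on `Ω × Ω`; the number `F(x - y)` is viewed as an operator
on `ℂ`. -/
def kernelMatrix (F : ContPosDef Ω) : Matrix Ω Ω (ℂ →L[ℂ] ℂ) :=
  Matrix.of fun x y => F.toFun ((x : E n) - (y : E n)) • ContinuousLinearMap.id ℂ ℂ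

open scoped ComplexOrder in
theorem quad_nonneg (F : ContPosDef Ω) (f : Ω →₀ ℂ) :
    0 ≤ f.sum fun x a => f.sum fun y b =>
      conj a * b * F.toFun ((x : E n) - (y : E n)) := by
  classical
  have h := F.posDef f.support.card (fun i => ((f.support.equivFin.symm i : Ω) : E n))
    (fun i => f (f.support.equivFin.symm i : Ω)) (fun i => Subtype.coe_prop _)
  refine h.trans_eq ?_
  have key : ∀ g : Ω → ℂ,
      ∑ i, g (f.support.equivFin.symm i : Ω) = ∑ x ∈ f.support, g x := by
    intro g
    rw [← Finset.sum_coe_sort f.support]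
    exact Equiv.sum_comp f.support.equivFin.symm (fun x : f.support => g x)
  simp only [Finsupp.sum]
  rw [← key]
  exact Finset.sum_congr rfl fun i _ => key (fun y =>
    conj (f (f.support.equivFin.symm i : Ω)) * f y *
      F.toFun (((f.support.equivFin.symm i : Ω) : E n) - (y : E n)))

theorem conj_symm (F : ContPosDef Ω) {x y : E n} (hx : x ∈ Ω) (hy : y ∈ Ω) :
    conj (F.toFun (y - x)) = F.toFun (x - y) := by
  have h0 := (Complex.nonneg_iff.1 (F.posDef 1 ![x] ![1] (by simpa using hx))).2
  have h1 := (Complex.nonneg_iff.1 (F.posDef 2 ![x, y] ![1, 1] (by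
    intro i; fin_cases i <;> simpa))).2
  have h2 := (Complex.nonneg_iff.1 (F.posDef 2 ![x, y] ![1, Complex.I] (by
    intro i; fin_cases i <;> simpa))).2
  simp [Fin.sum_univ_two] at h0 h1 h2
  apply Complex.ext
  · simp; linarith
  · simp; linarith

theorem posSemidef_kernelMatrix (F : ContPosDef Ω) : F.kernelMatrix.PosSemidef := by
  have htfae := (RKHS.posSemidef_tfae (K := F.kernelMatrix)).out 0 2
  rw [htfae]
  refine ⟨?_, fun f => ?_⟩
  · ext x y
    have h := F.conj_symm x.2 y.2
    simp [kernelMatrix, ContinuousLinearMap.star_eq_adjoint, ContinuousLinearMap.adjoint_id, h]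
  · have h := (Complex.nonneg_iff.1 (F.quad_nonneg f)).1
    refine h.trans_eq ?_
    simp only [RCLike.re_to_complex]
    congr 1
    refine Finsupp.sum_congr fun x _ => Finsupp.sum_congr fun y _ => ?_
    have h := F.conj_symm x.2 y.2
    simp [kernelMatrix, h]
    ring

instance (F : ContPosDef Ω) : Fact F.kernelMatrix.PosSemidef := ⟨F.posSemidef_kernelMatrix⟩

/-- The reproducing kernel Hilbert space `ℋ_F` of the kernel `F(x - y)` on `Ω`. Its elements
coerce injectively to functions `Ω → ℂ`. -/
abbrev HF (F : ContPosDef Ω) : Type := RKHS.OfKernel F.kernelMatrix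

/-- The kernel function `F_x = F(· - x) ∈ ℋ_F`, for `x ∈ Ω`. -/
def kernelVec (F : ContPosDef Ω) (x : Ω) : F.HF := RKHS.kerFun F.HF x 1

theorem kernelVec_apply (F : ContPosDef Ω) (x y : Ω) :
    F.kernelVec x y = F.toFun ((y : E n) - (x : E n)) := by
  rw [kernelVec, RKHS.kerFun_apply, RKHS.OfKernel.kernel_ofKernel]
  simp [kernelMatrix]

/-- `Ext(F)`: the finite Borel measures on `ℝⁿ` whose Fourier transform
`x ↦ ∫ exp(i lam·x) dμ(lam)` extends `F`. -/
def Ext (F : ContPosDef Ω) : Set (Measure (E n)) :=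
  {μ | IsFiniteMeasure μ ∧ ∀ z ∈ Ω - Ω, F.toFun z = ∫ lam, expChar lam z ∂μ}

end ContPosDef

/-- A strongly continuous unitary representation of `ℝⁿ` on `H`. -/
structure UnitaryRep (n : ℕ) (H : Type*) [NormedAddCommGroup H] [InnerProductSpace ℂ H] where
  toFun : E n → (H ≃ₗᵢ[ℂ] H)
  map_zero : ∀ ξ, toFun 0 ξ = ξ
  map_add : ∀ s t ξ, toFun (s + t) ξ = toFun s (toFun t ξ)
  continuous : ∀ ξ, Continuous fun t => toFun t ξ

/-- A projection-valued measure on the Borel subsets of `ℝⁿ`, acting on `H`. Non-measurable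
sets are sent to `0`, so that a projection-valued measure is determined by its values on Borel
sets. -/
structure PVM (n : ℕ) (H : Type*) [NormedAddCommGroup H] [InnerProductSpace ℂ H]
    [CompleteSpace H] where
  toFun : Set (E n) → (H →L[ℂ] H)
  not_measurable : ∀ B, ¬ MeasurableSet B → toFun B = 0
  isStarProjection : ∀ B, IsStarProjection (toFun B)
  univ : toFun Set.univ = 1
  inter : ∀ A B, MeasurableSet A → MeasurableSet B → toFun (A ∩ B) = toFun A * toFun B
  hasSum_iUnion : ∀ B : ℕ → Set (E n), (∀ i, MeasurableSet (B i)) →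
    Pairwise (Function.onFun Disjoint B) →
    ∀ ξ, HasSum (fun i => toFun (B i) ξ) (toFun (⋃ i, B i) ξ)

namespace PVM

variable {n : ℕ} {H : Type*} [NormedAddCommGroup H] [InnerProductSpace ℂ H] [CompleteSpace H]

theorem empty (P : PVM n H) : P.toFun ∅ = 0 := by
  ext ξ
  have h := P.hasSum_iUnion (fun _ => ∅) (fun _ => MeasurableSet.empty)
    (fun i j _ => by simp [Function.onFun]) ξ
  exact (summable_const_iff _).1 h.summable

theorem normSq_eq (P : PVM n H) (B : Set (E n)) (ξ : H) :
    ‖P.toFun B ξ‖ ^ 2 = (⟪ξ, P.toFun B ξ⟫_ℂ).re := by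
  have h := P.isStarProjection B
  have h1 : P.toFun B (P.toFun B ξ) = P.toFun B ξ :=
    congrArg (fun T : H →L[ℂ] H => T ξ) h.isIdempotentElem.eq
  have h2 : ⟪P.toFun B ξ, P.toFun B ξ⟫_ℂ = ⟪ξ, P.toFun B ξ⟫_ℂ := by
    rw [← ContinuousLinearMap.adjoint_inner_right, ← ContinuousLinearMap.star_eq_adjoint,
      h.isSelfAdjoint.star_eq, h1]
  rw [← h2, inner_self_eq_norm_sq_to_K]
  norm_cast

/-- The scalar measure `B ↦ ‖P(B) ξ‖²` of a vector `ξ`. -/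
def scalarMeasure (P : PVM n H) (ξ : H) : Measure (E n) :=
  Measure.ofMeasurable (fun B _ => ENNReal.ofReal (‖P.toFun B ξ‖ ^ 2))
    (by simp [P.empty])
    (by
      intro B hB hd
      have h := P.hasSum_iUnion B hB hd ξ
      have h' : HasSum (fun i => ‖P.toFun (B i) ξ‖ ^ 2) (‖P.toFun (⋃ i, B i) ξ‖ ^ 2) := by
        simp only [normSq_eq]
        exact Complex.hasSum_re ((innerSL ℂ ξ).hasSum h)
      rw [← h'.tsum_eq]
      exact ENNReal.ofReal_tsum_of_nonneg (fun i => by positivity) h'.summable)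

theorem scalarMeasure_apply (P : PVM n H) (ξ : H) {B : Set (E n)} (hB : MeasurableSet B) :
    P.scalarMeasure ξ B = ENNReal.ofReal (‖P.toFun B ξ‖ ^ 2) :=
  Measure.ofMeasurable_apply B hB

/-- `P` is the projection-valued measure of `U`, that is `U(t) = ∫ exp(i t·lam) P(dlam)` for all
`t`. Both sides are bounded operators, so it is enough to compare their quadratic forms. -/
def Represents (P : PVM n H) (U : UnitaryRep n H) : Prop :=
  ∀ (t : E n) (ξ : H), ⟪ξ, U.toFun t ξ⟫_ℂ = ∫ lam, expChar lam t ∂(P.scalarMeasure ξ)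

/-- The closed subspace `V` is invariant under `U` and reduces `P`. -/
structure Reduces (V : Submodule ℂ H) (U : UnitaryRep n H) (P : PVM n H) : Prop where
  isClosed : IsClosed (V : Set H)
  map_unitary : ∀ t, ∀ ξ ∈ V, U.toFun t ξ ∈ V
  map_proj : ∀ B, ∀ ξ ∈ V, P.toFun B ξ ∈ V

end PVM

/-- `ν` is purely atomic: it is carried by a countable set of points. -/
def IsPurelyAtomic {n : ℕ} (ν : Measure (E n)) : Prop :=
  ∃ S : Set (E n), S.Countable ∧ ν Sᶜ = 0

/-- `ν` is continuous (has no atoms) and purely singular with respect to Lebesgue measure. -/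
def IsContinuousSingular {n : ℕ} (ν : Measure (E n)) : Prop :=
  (∀ lam, ν {lam} = 0) ∧ ν ⟂ₘ (volume : Measure (E n))

/-- `ξt : ℝⁿ → ℂ` is a `μ`-extension of `ξ : Ω → ℂ`: it is `(f dμ)^∨` for some `f ∈ L²(μ)`, and
it restricts to `ξ` on `Ω`. -/
def IsMuExtension {n : ℕ} {Ω : Set (E n)} (μ : Measure (E n)) (ξ : Ω → ℂ) (ξt : E n → ℂ) : Prop :=
  ∃ f : E n → ℂ, MemLp f 2 μ ∧ ξt = measureInvFourier μ f ∧ ∀ x : Ω, ξt x = ξ x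

namespace ContPosDef

variable {n : ℕ} {Ω : Set (E n)}

/-- `U` is a unitary representation on `ℋ_F` corresponding to the extension `μ`, with base vector
`F₀ = v₀`: it continues the local translations of the kernel functions, `F_x = U(-x) F₀` for
`x ∈ Ω`, and `⟨F₀, U(t) F₀⟩ = ∫ exp(i t·lam) dμ(lam)` for all `t ∈ ℝⁿ`. -/
structure Corresponds (F : ContPosDef Ω) (μ : Measure (E n)) (U : UnitaryRep n F.HF)
    (v₀ : F.HF) : Prop where
  translate : ∀ x : Ω, U.toFun (-(x : E n)) v₀ = F.kernelVec x
  extension : ∀ t, ⟪v₀, U.toFun t v₀⟫_ℂ = ∫ lam, expChar lam t ∂μ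

/-- `v` is the vector `F_φ = ∫_Ω φ(y) F(· - y) dy` of `ℋ_F`. -/
def IsSmeared (F : ContPosDef Ω) (φ : E n → ℂ) (v : F.HF) : Prop :=
  ∀ x : Ω, v x = ∫ y in Ω, φ y * F.toFun ((x : E n) - y)

/-- Every value of the projection-valued measure at an atom `lam` is the projection onto the
line spanned by `e_lam` restricted to `Ω`; this restriction lies in `ℋ_F`. -/
def AtomicCase (F : ContPosDef Ω) (P : PVM n F.HF) : Prop :=
  ∀ lam : E n, P.toFun {lam} ≠ 0 →
    Module.finrank ℂ (P.toFun {lam}).range = 1 ∧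
    ∃ e : F.HF, (∀ x : Ω, e x = expChar lam x) ∧ (P.toFun {lam}).range = Submodule.span ℂ {e}

/-- The description of the vectors `ξ` of the absolutely continuous subspace `V`. -/
def AbsContCase (F : ContPosDef Ω) (μ : Measure (E n)) (V : Submodule ℂ F.HF) : Prop :=
  ∀ ξ ∈ V,
    Continuous (fun x : Ω => ξ x) ∧
    (∀ φ, IsCc Ω φ → ∃ v : F.HF, F.IsSmeared φ v ∧
      ⟪ξ, v⟫_ℂ = pairing (fun x : Ω => ξ x) φ) ∧
    (∃ f : E n → ℂ, MemLp f 2 μ ∧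
      (∀ φ, IsCc Ω φ → pairing (fun x : Ω => ξ x) φ =
        ∫ lam, conj (f lam) * fourierHat φ lam ∂μ) ∧
      (∀ x : Ω, ξ x = measureInvFourier μ f x) ∧
      IsMuExtension μ (fun x : Ω => ξ x) (measureInvFourier μ f)) ∧
    ∀ ξt : E n → ℂ, IsMuExtension μ (fun x : Ω => ξ x) ξt →
      Continuous ξt ∧ Tendsto ξt (cocompact (E n)) (𝓝 0)

end ContPosDef

end LocalPD

end

noncomputable section

namespace LocalPD

variable {n : ℕ}

/-! The vector `v₀` is cyclic for `U`: its orbit contains all kernel functions, and a vector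
orthogonal to these vanishes as a function on Ω. The Gram matrix ⟨U(s)v₀, U(t)v₀⟩ = ∫
exp(i(t-s)·lam) dμ is also that of the exponentials in L²(μ), which are total there by Fourier
uniqueness. Hence there is a unitary Φ from ℋ_F onto L²(μ) that turns `U` into multiplication by
exponentials (`UnitaryRep.exists_spectral_model`). In this model P_U is multiplication by indicator
functions, μ_ξ = |Φξ|² dμ, and the reproducing property reads ξ = (Φξ dμ)^∨ on Ω
(`apply_eq_measureInvFourier`).

The claims are then statements about L²(μ). Disjoint carriers of the three Lebesgue parts of μ
(`exists_lebesgue_partition`) split the space, and since μ_ξ ≪ μ, the carrier of μ_ξ determines its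
type. At an atom, P({lam}) leaves functions supported at lam, whose transforms are multiples of
e_lam. On the absolutely continuous part Φξ dμ has a Lebesgue density, so the Riemann–Lebesgue lemma
gives decay; it applies to every μ-extension because there is only one, elements of ℋ_F being
determined by their values on Ω. -/

/-! ### Exponentials, Fourier uniqueness and the Riemann–Lebesgue lemma -/

theorem expChar_eq (lam x : E n) :
    expChar lam x = Complex.exp (((inner ℝ lam x : ℝ) : ℂ) * Complex.I) := by
  rw [expChar, mul_comm]

@[simp]
theorem norm_expChar (lam x : E n) : ‖expChar lam x‖ = 1 := by
  rw [expChar_eq, Complex.norm_exp_ofReal_mul_I]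

theorem continuous_expChar_uncurry : Continuous fun p : E n × E n => expChar p.1 p.2 := by
  unfold expChar
  fun_prop

theorem continuous_expChar_left (x : E n) : Continuous fun lam => expChar lam x := by
  unfold expChar
  fun_prop

theorem continuous_expChar_right (lam : E n) : Continuous fun x => expChar lam x := by
  unfold expChar
  fun_prop

theorem expChar_add (lam s t : E n) : expChar lam (s + t) = expChar lam s * expChar lam t := by
  simp [expChar, inner_add_right, mul_add, Complex.exp_add]

theorem conj_expChar (lam t : E n) : conj (expChar lam t) = expChar lam (-t) := by
  simp [expChar, ← Complex.exp_conj]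

theorem integral_expChar_eq_charFun (μ : Measure (E n)) (t : E n) :
    ∫ lam, expChar lam t ∂μ = charFun μ t := by
  rw [charFun_apply]
  exact integral_congr_ae (.of_forall fun lam => expChar_eq lam t)

theorem measure_ext_of_integral_expChar {μ ν : Measure (E n)} [IsFiniteMeasure μ]
    [IsFiniteMeasure ν] (h : ∀ t, ∫ lam, expChar lam t ∂μ = ∫ lam, expChar lam t ∂ν) : μ = ν := by
  refine Measure.ext_of_charFun (funext fun t => ?_)
  simpa only [integral_expChar_eq_charFun] using h t

theorem integrable_expChar_mul {μ : Measure (E n)} {f : E n → ℂ} (hf : Integrable f μ) (t : E n) :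
    Integrable (fun lam => expChar lam t * f lam) μ :=
  hf.bdd_mul (c := 1) (continuous_expChar_left t).aestronglyMeasurable (by simp)

/-- The positive and negative parts of `g` are densities of two finite measures with equal Fourier
transforms. These parts therefore agree almost everywhere, and at each point one of them is zero. -/
theorem ae_eq_zero_of_integral_expChar_mul_ofReal {μ : Measure (E n)} {g : E n → ℝ}
    (hg : Integrable g μ) (h : ∀ t, ∫ lam, expChar lam t * (g lam : ℂ) ∂μ = 0) :
    g =ᵐ[μ] 0 := by
  have hpos := hg.lintegral_lt_top
  have hneg := hg.neg.lintegral_lt_top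
  have hm : AEMeasurable (fun lam => ENNReal.ofReal (g lam)) μ := hg.aemeasurable.ennreal_ofReal
  have hm' : AEMeasurable (fun lam => ENNReal.ofReal (-g lam)) μ :=
    hg.neg.aemeasurable.ennreal_ofReal
  have : IsFiniteMeasure (μ.withDensity fun lam => ENNReal.ofReal (g lam)) :=
    isFiniteMeasure_withDensity hpos.ne
  have : IsFiniteMeasure (μ.withDensity fun lam => ENNReal.ofReal (-g lam)) :=
    isFiniteMeasure_withDensity hneg.ne
  have key : (μ.withDensity fun lam => ENNReal.ofReal (g lam)) =
      μ.withDensity fun lam => ENNReal.ofReal (-g lam) := by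
    refine measure_ext_of_integral_expChar fun t => ?_
    rw [integral_withDensity_eq_integral_toReal_smul₀ hm (by simp),
      integral_withDensity_eq_integral_toReal_smul₀ hm' (by simp), ← sub_eq_zero,
      ← integral_sub, ← h t]
    · refine integral_congr_ae (.of_forall fun lam => ?_)
      simp only [ENNReal.toReal_ofReal', Complex.real_smul]
      rw [← sub_mul, mul_comm, ← Complex.ofReal_sub]
      congr 2
      rcases le_total (g lam) 0 with h0 | h0 <;> simp [h0]
    · have := integrable_expChar_mul (hg.pos_part.ofReal (𝕜 := ℂ)) t
      simpa [ENNReal.toReal_ofReal', mul_comm] using this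
    · have := integrable_expChar_mul (hg.neg_part.ofReal (𝕜 := ℂ)) t
      simpa [ENNReal.toReal_ofReal', mul_comm] using this
  filter_upwards [(withDensity_eq_iff hm hm' hpos.ne).1 key] with lam hlam
  rcases le_total (g lam) 0 with h0 | h0
  · rw [ENNReal.ofReal_of_nonpos h0] at hlam
    have := ENNReal.ofReal_eq_zero.1 hlam.symm
    simp only [Pi.zero_apply]
    linarith
  · rw [ENNReal.ofReal_of_nonpos (by linarith : -g lam ≤ 0)] at hlam
    have := ENNReal.ofReal_eq_zero.1 hlam
    simp only [Pi.zero_apply]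
    linarith

/-- An integrable density whose Fourier transform vanishes is zero almost everywhere. -/
theorem ae_eq_zero_of_integral_expChar_mul {μ : Measure (E n)} {h : E n → ℂ}
    (hh : Integrable h μ) (h0 : ∀ t, ∫ lam, expChar lam t * h lam ∂μ = 0) : h =ᵐ[μ] 0 := by
  have hconj : Integrable (fun lam => conj (h lam)) μ :=
    (Complex.conjCLE : ℂ →L[ℝ] ℂ).integrable_comp hh
  -- Conjugation replaces `t` by `-t`, so the transform of the conjugate vanishes too, and with it
  -- those of the real and imaginary parts.
  have hc : ∀ t, ∫ lam, expChar lam t * conj (h lam) ∂μ = 0 := by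
    intro t
    have := congrArg conj (h0 (-t))
    rw [← integral_conj] at this
    simpa [conj_expChar] using this
  have hre : (fun lam => (h lam).re) =ᵐ[μ] 0 := by
    refine ae_eq_zero_of_integral_expChar_mul_ofReal hh.re fun t => ?_
    have := integral_add (integrable_expChar_mul hh t) (integrable_expChar_mul hconj t)
    rw [h0, hc, add_zero] at this
    rw [← mul_zero (2⁻¹ : ℂ), ← this, ← integral_const_mul]
    refine integral_congr_ae (.of_forall fun lam => ?_)
    simp only [← mul_add, Complex.add_conj]
    push_cast
    ring
  have him : (fun lam => (h lam).im) =ᵐ[μ] 0 := by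
    refine ae_eq_zero_of_integral_expChar_mul_ofReal hh.im fun t => ?_
    have := integral_sub (integrable_expChar_mul hh t) (integrable_expChar_mul hconj t)
    rw [h0, hc, sub_zero] at this
    rw [← mul_zero ((2 * Complex.I)⁻¹ : ℂ), ← this, ← integral_const_mul]
    refine integral_congr_ae (.of_forall fun lam => ?_)
    simp only [← mul_sub, Complex.sub_conj]
    push_cast
    field_simp
  filter_upwards [hre, him] with lam h1 h2
  exact Complex.ext h1 h2

/-- The Riemann–Lebesgue lemma for the exponentials `expChar`. -/
theorem tendsto_integral_expChar_mul_cocompact (f : E n → ℂ) :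
    Tendsto (fun x => ∫ lam, expChar lam x * f lam) (cocompact (E n)) (𝓝 0) := by
  have h := tendsto_integral_exp_inner_smul_cocompact (V := E n) f
  -- The lemma just quoted uses exp(-2πi⟨v,w⟩); the dilation w = -(2π)⁻¹x restores exp(i⟨v,x⟩).
  have hc : (-(2 * Real.pi)⁻¹ : ℝ) ≠ 0 := by simp [Real.pi_ne_zero]
  have h2 := h.comp (Homeomorph.smulOfNeZero (α := E n) (-(2 * Real.pi)⁻¹ : ℝ)
    hc).isClosedEmbedding.tendsto_cocompact
  refine h2.congr fun x => integral_congr_ae (.of_forall fun lam => ?_)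
  have hpi : (Real.pi : ℂ) ≠ 0 := by exact_mod_cast Real.pi_ne_zero
  simp only [Homeomorph.smulOfNeZero_apply, inner_smul_right, Circle.smul_def, smul_eq_mul,
    Real.fourierChar_apply, expChar]
  congr 2
  push_cast
  field_simp

/-! ### Multiplication by indicator functions as a projection-valued measure -/

/-- The product of the indicator function of `B` and `f`, in `L²(μ)`. -/
def indicatorLp {μ : Measure (E n)} {B : Set (E n)} (hB : MeasurableSet B) (f : Lp ℂ 2 μ) :
    Lp ℂ 2 μ :=
  MemLp.toLp (B.indicator f) ((Lp.memLp f).indicator hB)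

theorem coeFn_indicatorLp {μ : Measure (E n)} {B : Set (E n)} (hB : MeasurableSet B)
    (f : Lp ℂ 2 μ) : indicatorLp hB f =ᵐ[μ] B.indicator f :=
  MemLp.coeFn_toLp _

/-- Multiplication by the indicator function of `B`, as an operator on `L²(μ)`. -/
def indicatorOp (μ : Measure (E n)) (B : Set (E n)) (hB : MeasurableSet B) :
    Lp ℂ 2 μ →L[ℂ] Lp ℂ 2 μ :=
  LinearMap.mkContinuous
    { toFun := indicatorLp hB
      map_add' := by
        intro f g
        refine Lp.ext ?_
        filter_upwards [coeFn_indicatorLp hB (f + g), coeFn_indicatorLp hB f,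
          coeFn_indicatorLp hB g, Lp.coeFn_add f g,
          Lp.coeFn_add (indicatorLp hB f) (indicatorLp hB g)] with x h1 h2 h3 h4 h5
        rw [h1, h5, Pi.add_apply, h2, h3]
        by_cases h : x ∈ B
        · simp only [Set.indicator_of_mem h, h4, Pi.add_apply]
        · simp only [Set.indicator_of_notMem h, add_zero]
      map_smul' := by
        intro c f
        refine Lp.ext ?_
        filter_upwards [coeFn_indicatorLp hB (c • f), coeFn_indicatorLp hB f,
          Lp.coeFn_smul c f, Lp.coeFn_smul c (indicatorLp hB f)] with x h1 h2 h3 h4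
        rw [h1, RingHom.id_apply, h4, Pi.smul_apply, h2]
        by_cases h : x ∈ B
        · simp only [Set.indicator_of_mem h, h3, Pi.smul_apply]
        · simp only [Set.indicator_of_notMem h, smul_zero] } 1 (by
      intro f
      rw [one_mul, LinearMap.coe_mk, AddHom.coe_mk, indicatorLp, Lp.norm_toLp, Lp.norm_def]
      exact ENNReal.toReal_mono (Lp.eLpNorm_ne_top f) (eLpNorm_indicator_le _))

theorem indicatorOp_coeFn (μ : Measure (E n)) {B : Set (E n)} (hB : MeasurableSet B)
    (f : Lp ℂ 2 μ) : indicatorOp μ B hB f =ᵐ[μ] B.indicator f :=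
  coeFn_indicatorLp hB f

theorem normSq_Lp_eq_integral {μ : Measure (E n)} (f : Lp ℂ 2 μ) :
    ‖f‖ ^ 2 = ∫ lam, ‖f lam‖ ^ 2 ∂μ := by
  have h : ⟪f, f⟫_ℂ = ((∫ lam, ‖f lam‖ ^ 2 ∂μ : ℝ) : ℂ) := by
    rw [L2.inner_def, ← integral_complex_ofReal]
    refine integral_congr_ae (.of_forall fun lam => ?_)
    simp only [inner_self_eq_norm_sq_to_K]
    norm_cast
  have h2 := inner_self_eq_norm_sq (𝕜 := ℂ) f
  rw [h] at h2
  simpa using h2.symm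

theorem integrable_normSq_Lp {μ : Measure (E n)} (f : Lp ℂ 2 μ) :
    Integrable (fun lam => ‖f lam‖ ^ 2) μ :=
  (Lp.memLp f).integrable_norm_pow (by norm_num)

theorem normSq_indicatorOp {μ : Measure (E n)} {B : Set (E n)} (hB : MeasurableSet B)
    (f : Lp ℂ 2 μ) : ‖indicatorOp μ B hB f‖ ^ 2 = ∫ lam in B, ‖f lam‖ ^ 2 ∂μ := by
  rw [normSq_Lp_eq_integral, ← integral_indicator hB]
  refine integral_congr_ae ?_
  filter_upwards [indicatorOp_coeFn μ hB f] with x hx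
  by_cases h : x ∈ B <;> simp [h, hx]

theorem indicatorOp_comp {μ : Measure (E n)} {A B : Set (E n)} (hA : MeasurableSet A)
    (hB : MeasurableSet B) (f : Lp ℂ 2 μ) :
    indicatorOp μ A hA (indicatorOp μ B hB f) = indicatorOp μ (A ∩ B) (hA.inter hB) f := by
  refine Lp.ext ?_
  filter_upwards [indicatorOp_coeFn μ hA (indicatorOp μ B hB f), indicatorOp_coeFn μ hB f,
    indicatorOp_coeFn μ (hA.inter hB) f] with x h1 h2 h3
  rw [h1, h3, ← Set.indicator_indicator]
  by_cases h : x ∈ A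
  · rw [Set.indicator_of_mem h, Set.indicator_of_mem h, h2]
  · rw [Set.indicator_of_notMem h, Set.indicator_of_notMem h]

theorem inner_indicatorOp {μ : Measure (E n)} {B : Set (E n)} (hB : MeasurableSet B)
    (f g : Lp ℂ 2 μ) : ⟪indicatorOp μ B hB f, g⟫_ℂ = ⟪f, indicatorOp μ B hB g⟫_ℂ := by
  rw [L2.inner_def, L2.inner_def]
  refine integral_congr_ae ?_
  filter_upwards [indicatorOp_coeFn μ hB f, indicatorOp_coeFn μ hB g] with x h1 h2
  rw [h1, h2]
  by_cases h : x ∈ B <;> simp [h]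

/-- Orthogonal pieces of a vector whose squared norms exhaust that of the vector sum to it. -/
theorem hasSum_of_hasSum_normSq {H : Type*} [NormedAddCommGroup H] [InnerProductSpace ℂ H]
    {a : H} {v : ℕ → H} (hav : ∀ i, ⟪a, v i⟫_ℂ = ⟪v i, v i⟫_ℂ)
    (hv : ∀ i j, i ≠ j → ⟪v i, v j⟫_ℂ = 0) (hs : HasSum (fun i => ‖v i‖ ^ 2) (‖a‖ ^ 2)) :
    HasSum v a := by
  -- The remainder is orthogonal to each `v i` with `i ∈ s`, so its squared norm is the defect in
  -- Bessel's inequality.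
  have key : ∀ s : Finset ℕ, ‖(∑ i ∈ s, v i) - a‖ ^ 2 = ‖a‖ ^ 2 - ∑ i ∈ s, ‖v i‖ ^ 2 := by
    intro s
    have hS : ‖∑ i ∈ s, v i‖ ^ 2 = ∑ i ∈ s, ‖v i‖ ^ 2 := by
      have : ((‖∑ i ∈ s, v i‖ ^ 2 : ℝ) : ℂ) = ((∑ i ∈ s, ‖v i‖ ^ 2 : ℝ) : ℂ) := by
        push_cast
        have h := inner_self_eq_norm_sq_to_K (𝕜 := ℂ) (∑ i ∈ s, v i)
        rw [sum_inner] at h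
        refine h.symm.trans (Finset.sum_congr rfl fun i hi => ?_)
        rw [inner_sum, Finset.sum_eq_single i (fun j _ hj => hv i j hj.symm)
          (fun h => absurd hi h), inner_self_eq_norm_sq_to_K]
        rfl
      exact_mod_cast this
    have hR : RCLike.re ⟪∑ i ∈ s, v i, a⟫_ℂ = ∑ i ∈ s, ‖v i‖ ^ 2 := by
      rw [sum_inner, map_sum]
      refine Finset.sum_congr rfl fun i _ => ?_
      rw [← inner_conj_symm, hav, inner_conj_symm, inner_self_eq_norm_sq]
    rw [@norm_sub_sq ℂ, hS, hR]
    ring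
  rw [HasSum, SummationFilter.unconditional_filter, tendsto_iff_norm_sub_tendsto_zero]
  rw [HasSum, SummationFilter.unconditional_filter] at hs
  have h2 : Tendsto (fun s : Finset ℕ => ‖(∑ i ∈ s, v i) - a‖ ^ 2) atTop (𝓝 0) := by
    simp_rw [key]
    have h := hs.const_sub (‖a‖ ^ 2)
    rwa [sub_self] at h
  simpa using h2.sqrt

section Multiplication

variable {H : Type*} [NormedAddCommGroup H] [InnerProductSpace ℂ H] [CompleteSpace H]

/-- The pieces are orthogonal, and countable additivity of ∫ |f|² dμ says that their squared norms
exhaust the total. This gives convergence in norm. -/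
theorem hasSum_indicatorOp {μ : Measure (E n)} {B : ℕ → Set (E n)}
    (hB : ∀ i, MeasurableSet (B i)) (hd : Pairwise (Function.onFun Disjoint B)) (f : Lp ℂ 2 μ) :
    HasSum (fun i => indicatorOp μ (B i) (hB i) f)
      (indicatorOp μ (⋃ i, B i) (MeasurableSet.iUnion hB) f) := by
  refine hasSum_of_hasSum_normSq (fun i => ?_) (fun i j hij => ?_) ?_
  · rw [inner_indicatorOp, inner_indicatorOp, indicatorOp_comp, indicatorOp_comp]
    congr 3
    rw [Set.inter_self, Set.inter_eq_right]
    exact Set.subset_iUnion B i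
  · rw [inner_indicatorOp, indicatorOp_comp]
    have h0 : B i ∩ B j = ∅ := (hd hij).inter_eq
    have : indicatorOp μ (B i ∩ B j) ((hB i).inter (hB j)) f = 0 := by
      have h := normSq_indicatorOp ((hB i).inter (hB j)) f
      have h' : ∫ lam in B i ∩ B j, ‖f lam‖ ^ 2 ∂μ = 0 := by
        rw [h0, Measure.restrict_empty, integral_zero_measure]
      rw [h'] at h
      exact norm_eq_zero.1 (pow_eq_zero_iff two_ne_zero |>.1 h)
    rw [this, inner_zero_right]
  · simp only [normSq_indicatorOp]
    exact hasSum_integral_iUnion hB hd (integrable_normSq_Lp f).integrableOn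

open Classical in
/-- The projection-valued measure of multiplication by indicator functions on `L²(μ)`, carried
over to a Hilbert space that is unitarily equivalent to `L²(μ)`. -/
def multiplicationPVM {μ : Measure (E n)} (Φ : H ≃ₗᵢ[ℂ] Lp ℂ 2 μ) : PVM n H where
  toFun B := if hB : MeasurableSet B then
    (Φ.symm.toContinuousLinearEquiv : Lp ℂ 2 μ →L[ℂ] H) ∘L indicatorOp μ B hB ∘L
      (Φ.toContinuousLinearEquiv : H →L[ℂ] Lp ℂ 2 μ) else 0
  not_measurable B hB := by simp [hB]
  isStarProjection B := by
    by_cases hB : MeasurableSet B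
    · simp only [hB, dite_true]
      refine ⟨?_, ?_⟩
      · ext ξ
        simp [indicatorOp_comp]
      · rw [ContinuousLinearMap.isSelfAdjoint_iff_isSymmetric]
        intro ξ η
        simp only [ContinuousLinearMap.coe_coe, ContinuousLinearMap.comp_apply,
          ContinuousLinearEquiv.coe_coe, LinearIsometryEquiv.coe_toContinuousLinearEquiv]
        rw [← Φ.inner_map_map, ← Φ.inner_map_map ξ, Φ.apply_symm_apply, Φ.apply_symm_apply,
          inner_indicatorOp]
    · simp only [hB, dite_false]
      exact IsStarProjection.zero _
  univ := by
    ext ξ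
    simp only [MeasurableSet.univ, dite_true, ContinuousLinearMap.comp_apply,
      ContinuousLinearEquiv.coe_coe, LinearIsometryEquiv.coe_toContinuousLinearEquiv,
      one_apply_eq_self]
    rw [Φ.symm_apply_eq]
    refine Lp.ext ?_
    filter_upwards [indicatorOp_coeFn μ MeasurableSet.univ (Φ ξ)] with x hx
    simp [hx]
  inter A B hA hB := by
    ext ξ
    simp [hA, hB, hA.inter hB, indicatorOp_comp]
  hasSum_iUnion B hB hd ξ := by
    simpa [hB, MeasurableSet.iUnion hB] using
      (Φ.symm.toContinuousLinearEquiv : Lp ℂ 2 μ →L[ℂ] H).hasSum (hasSum_indicatorOp hB hd (Φ ξ))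

theorem map_multiplicationPVM {μ : Measure (E n)} (Φ : H ≃ₗᵢ[ℂ] Lp ℂ 2 μ) {B : Set (E n)}
    (hB : MeasurableSet B) (ξ : H) :
    Φ ((multiplicationPVM Φ).toFun B ξ) = indicatorOp μ B hB (Φ ξ) := by
  simp [multiplicationPVM, hB]

/-- The explicit density makes every scalar measure absolutely continuous with respect to `μ`. -/
theorem scalarMeasure_multiplicationPVM {μ : Measure (E n)} (Φ : H ≃ₗᵢ[ℂ] Lp ℂ 2 μ) (ξ : H) :
    (multiplicationPVM Φ).scalarMeasure ξ =
      μ.withDensity fun lam => ((‖(Φ ξ : E n → ℂ) lam‖₊ ^ 2 : NNReal) : ℝ≥0∞) := by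
  ext B hB
  rw [PVM.scalarMeasure_apply _ _ hB, withDensity_apply _ hB, ← Φ.norm_map,
    map_multiplicationPVM Φ hB, normSq_indicatorOp,
    ofReal_integral_eq_lintegral_ofReal (integrable_normSq_Lp _).integrableOn
      (.of_forall fun _ => by positivity)]
  refine lintegral_congr fun lam => ?_
  rw [← coe_nnnorm, ← NNReal.coe_pow, ENNReal.ofReal_coe_nnreal]

/-- If `U` is multiplication by the exponentials, its projection-valued measure is multiplication
by indicator functions. -/
theorem represents_multiplicationPVM {μ : Measure (E n)} (Φ : H ≃ₗᵢ[ℂ] Lp ℂ 2 μ)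
    {U : UnitaryRep n H}
    (hU : ∀ t ξ, (Φ (U.toFun t ξ) : E n → ℂ) =ᵐ[μ] fun lam => expChar lam t * Φ ξ lam) :
    (multiplicationPVM Φ).Represents U := by
  intro t ξ
  have hm : Measurable fun lam => ‖(Φ ξ : E n → ℂ) lam‖₊ ^ 2 :=
    (Lp.stronglyMeasurable (Φ ξ)).measurable.nnnorm.pow_const 2
  rw [scalarMeasure_multiplicationPVM, integral_withDensity_eq_integral_smul hm,
    ← Φ.inner_map_map, L2.inner_def]
  refine integral_congr_ae ?_
  filter_upwards [hU t ξ] with lam h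
  rw [h, RCLike.inner_apply, NNReal.smul_def, mul_assoc, Complex.mul_conj, Complex.real_smul,
    Complex.normSq_eq_norm_sq]
  push_cast
  ring

end Multiplication

/-! ### Uniqueness of the projection-valued measure and its spectral subspaces -/

namespace PVM

variable {H : Type*} [NormedAddCommGroup H] [InnerProductSpace ℂ H] [CompleteSpace H]

instance (P : PVM n H) (ξ : H) : IsFiniteMeasure (P.scalarMeasure ξ) :=
  ⟨by rw [P.scalarMeasure_apply ξ MeasurableSet.univ]; exact ENNReal.ofReal_lt_top⟩

theorem inner_apply (P : PVM n H) (B : Set (E n)) (ξ η : H) :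
    ⟪P.toFun B ξ, η⟫_ℂ = ⟪ξ, P.toFun B η⟫_ℂ :=
  (ContinuousLinearMap.isSelfAdjoint_iff_isSymmetric.1 (P.isStarProjection B).isSelfAdjoint) ξ η

theorem apply_inter (P : PVM n H) {A B : Set (E n)} (hA : MeasurableSet A)
    (hB : MeasurableSet B) (ξ : H) : P.toFun (A ∩ B) ξ = P.toFun A (P.toFun B ξ) := by
  rw [P.inter A B hA hB, mul_apply_eq_comp]

/-- Countable additivity applied to `A`, `B`, ∅, ∅, … -/
theorem apply_union (P : PVM n H) {A B : Set (E n)} (hA : MeasurableSet A)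
    (hB : MeasurableSet B) (hd : Disjoint A B) (ξ : H) :
    P.toFun (A ∪ B) ξ = P.toFun A ξ + P.toFun B ξ := by
  let C : ℕ → Set (E n) := fun i => if i = 0 then A else if i = 1 then B else ∅
  have hC : ⋃ i, C i = A ∪ B := by
    ext x
    simp only [Set.mem_iUnion, Set.mem_union, C]
    constructor
    · rintro ⟨i, hi⟩
      split_ifs at hi
      · exact .inl hi
      · exact .inr hi
      · exact hi.elim
    · rintro (h | h)
      · exact ⟨0, by simpa⟩
      · exact ⟨1, by simpa⟩
  have h := P.hasSum_iUnion C (by intro i; simp only [C]; split_ifs <;> simp [hA, hB])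
    (by
      intro i j hij
      simp only [Function.onFun, C]
      split_ifs <;> simp_all [disjoint_comm]) ξ
  rw [hC] at h
  refine h.unique ?_
  have h2 : HasSum _ _ := hasSum_sum_of_ne_finset_zero (L := .unconditional ℕ)
    (f := fun i => P.toFun (C i) ξ) (s := {0, 1}) (by
    intro i hi
    simp only [Finset.mem_insert, Finset.mem_singleton, not_or] at hi
    simp [C, hi.1, hi.2, P.empty])
  simpa [C] using h2

theorem apply_eq_zero_iff (P : PVM n H) {B : Set (E n)} (hB : MeasurableSet B) (ξ : H) :
    P.toFun B ξ = 0 ↔ P.scalarMeasure ξ B = 0 := by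
  rw [P.scalarMeasure_apply ξ hB, ENNReal.ofReal_eq_zero]
  constructor
  · intro h
    simp [h]
  · intro h
    have := le_antisymm h (by positivity)
    simpa using this

/-- A projection-valued measure is determined by its scalar measures. -/
theorem ext_of_scalarMeasure {P Q : PVM n H} (h : ∀ ξ, P.scalarMeasure ξ = Q.scalarMeasure ξ) :
    P = Q := by
  have key : P.toFun = Q.toFun := by
    funext B
    by_cases hB : MeasurableSet B
    · have hre : ∀ ξ, (⟪ξ, P.toFun B ξ⟫_ℂ).re = (⟪ξ, Q.toFun B ξ⟫_ℂ).re := by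
        intro ξ
        rw [← normSq_eq, ← normSq_eq]
        have := congrArg (fun ν : Measure (E n) => (ν B).toReal) (h ξ)
        simpa [scalarMeasure_apply _ _ hB, ENNReal.toReal_ofReal (sq_nonneg _)] using this
      have him : ∀ (R : PVM n H) ξ, (⟪ξ, R.toFun B ξ⟫_ℂ).im = 0 := by
        intro R ξ
        rw [← Complex.conj_eq_iff_im, inner_conj_symm, inner_apply]
      -- Over ℂ the quadratic form determines the operator, by polarization.
      have : (P.toFun B : H →ₗ[ℂ] H) = Q.toFun B := by
        refine (ext_inner_map _ _).1 fun ξ => ?_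
        simp only [ContinuousLinearMap.coe_coe, inner_apply]
        exact Complex.ext (hre ξ) (by rw [him, him])
      exact ContinuousLinearMap.coe_injective this
    · rw [P.not_measurable B hB, Q.not_measurable B hB]
  cases P
  cases Q
  cases key
  rfl

/-- The Fourier transform of a scalar measure is the matrix coefficient t ↦ ⟨ξ, U(t)ξ⟩, which
depends on `U` alone. -/
theorem Represents.unique {P Q : PVM n H} {U : UnitaryRep n H} (hP : P.Represents U)
    (hQ : Q.Represents U) : P = Q :=
  ext_of_scalarMeasure fun ξ => measure_ext_of_integral_expChar fun t => by
    rw [← hP t ξ, ← hQ t ξ]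

/-- U(t) is isometric and commutes with U(s), so ξ and U(t)ξ have the same matrix coefficient. This
gives invariance of `carried` without proving that `P` commutes with `U`. -/
theorem Represents.scalarMeasure_unitary {P : PVM n H} {U : UnitaryRep n H}
    (hP : P.Represents U) (t : E n) (ξ : H) :
    P.scalarMeasure (U.toFun t ξ) = P.scalarMeasure ξ := by
  refine measure_ext_of_integral_expChar fun s => ?_
  rw [← hP, ← hP, ← U.map_add, add_comm, U.map_add, LinearIsometryEquiv.inner_map_map]

/-- The subspace of the vectors whose scalar measure is carried by `B`. -/
def carried (P : PVM n H) (B : Set (E n)) : Submodule ℂ H :=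
  LinearMap.ker (P.toFun Bᶜ : H →ₗ[ℂ] H)

theorem mem_carried (P : PVM n H) {B : Set (E n)} (hB : MeasurableSet B) {ξ : H} :
    ξ ∈ P.carried B ↔ P.scalarMeasure ξ Bᶜ = 0 := by
  rw [← P.apply_eq_zero_iff hB.compl]
  rfl

theorem apply_mem_carried (P : PVM n H) {B : Set (E n)} (hB : MeasurableSet B) (ξ : H) :
    P.toFun B ξ ∈ P.carried B := by
  change P.toFun Bᶜ (P.toFun B ξ) = 0
  rw [← P.apply_inter hB.compl hB, Set.compl_inter_self, P.empty, zero_apply]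

theorem apply_of_mem_carried (P : PVM n H) {B : Set (E n)} (hB : MeasurableSet B) {ξ : H}
    (h : ξ ∈ P.carried B) : P.toFun B ξ = ξ := by
  have h1 := P.apply_union hB hB.compl disjoint_compl_right ξ
  have h2 : P.toFun Bᶜ ξ = 0 := h
  rw [Set.union_compl_self, P.univ, h2, add_zero] at h1
  exact h1.symm

theorem Represents.reduces_carried {P : PVM n H} {U : UnitaryRep n H} (hP : P.Represents U)
    {B : Set (E n)} (hB : MeasurableSet B) : Reduces (P.carried B) U P where
  isClosed := (P.toFun Bᶜ).isClosed_ker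
  map_unitary t ξ hξ := by
    rw [P.mem_carried hB] at hξ ⊢
    rwa [hP.scalarMeasure_unitary]
  map_proj C ξ hξ := by
    by_cases hC : MeasurableSet C
    · change P.toFun Bᶜ (P.toFun C ξ) = 0
      have h : P.toFun Bᶜ ξ = 0 := hξ
      rw [← P.apply_inter hB.compl hC, Set.inter_comm, P.apply_inter hC hB.compl, h,
        _root_.map_zero]
    · rw [P.not_measurable C hC]
      exact Submodule.zero_mem _

theorem carried_isOrtho (P : PVM n H) {A B : Set (E n)} (hA : MeasurableSet A)
    (hB : MeasurableSet B) (hd : Disjoint A B) : P.carried A ⟂ P.carried B := by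
  rw [Submodule.isOrtho_iff_inner_eq]
  intro ξ hξ η hη
  rw [← P.apply_of_mem_carried hA hξ, ← P.apply_of_mem_carried hB hη, P.inner_apply,
    ← P.apply_inter hA hB, hd.inter_eq, P.empty, zero_apply, inner_zero_right]

theorem carried_sup_eq_top (P : PVM n H) {A B C : Set (E n)} (hA : MeasurableSet A)
    (hB : MeasurableSet B) (hC : MeasurableSet C) (hAB : Disjoint A B)
    (hABC : Disjoint (A ∪ B) C) (h : A ∪ B ∪ C = Set.univ) :
    P.carried A ⊔ P.carried B ⊔ P.carried C = ⊤ := by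
  rw [eq_top_iff]
  intro ξ _
  have h1 := P.apply_union (hA.union hB) hC hABC ξ
  rw [h, P.univ, P.apply_union hA hB hAB, one_apply_eq_self] at h1
  rw [h1]
  exact Submodule.add_mem_sup (Submodule.add_mem_sup (P.apply_mem_carried hA ξ)
    (P.apply_mem_carried hB ξ)) (P.apply_mem_carried hC ξ)

end PVM

/-! ### Carriers of the Lebesgue parts of μ -/

/-- Lebesgue decomposition of a finite measure into its atomic, absolutely continuous and
continuous singular parts, carried by disjoint sets `A`, `B`, `C`, and the induced
characterizations for all measures `ν ≪ μ`. -/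
theorem exists_lebesgue_partition (hn : 1 ≤ n) (μ : Measure (E n)) [IsFiniteMeasure μ] :
    ∃ A B C : Set (E n), (MeasurableSet A ∧ MeasurableSet B ∧ MeasurableSet C) ∧
      (Disjoint A B ∧ Disjoint A C ∧ Disjoint B C) ∧ A ∪ B ∪ C = Set.univ ∧
      μ.restrict B ≪ volume ∧
      ∀ ν : Measure (E n), ν ≪ μ →
        (ν Aᶜ = 0 ↔ IsPurelyAtomic ν) ∧ (ν Bᶜ = 0 ↔ ν ≪ volume) ∧
        (ν Cᶜ = 0 ↔ IsContinuousSingular ν) := by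
  -- In dimension 0 Lebesgue measure is a point mass; positive dimension makes countable sets
  -- Lebesgue null.
  have : Nonempty (Fin n) := ⟨⟨0, hn⟩⟩
  let A : Set (E n) := {lam | 0 < μ {lam}}
  have hAc : A.Countable := Measure.countable_meas_pos_of_disjoint_iUnion₀
      (As := fun lam : E n => {lam}) (fun _ => (measurableSet_singleton _).nullMeasurableSet)
      (fun i j hij => (Set.disjoint_singleton.2 hij).aedisjoint)
  have hA : MeasurableSet A := hAc.measurableSet
  let hs := Measure.mutuallySingular_singularPart μ (volume : Measure (E n))
  -- A Lebesgue null set carrying the singular part of `μ`; that part may still contain atoms, hence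
  -- the removal of `A` from `S` below.
  let S : Set (E n) := hs.nullSetᶜ
  have hS : MeasurableSet S := hs.measurableSet_nullSet.compl
  have hSv : volume S = 0 := hs.measure_compl_nullSet
  have hAv : volume A = 0 := hAc.measure_zero _
  have hac : μ.restrict Sᶜ ≪ volume := by
    intro T hT
    rw [Measure.restrict_apply₀' hS.compl.nullMeasurableSet]
    conv_lhs => rw [μ.haveLebesgueDecomposition_add volume]
    rw [Measure.add_apply, add_eq_zero]
    refine ⟨measure_mono_null Set.inter_subset_right ?_,
      withDensity_absolutelyContinuous _ _ (measure_mono_null Set.inter_subset_left hT)⟩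
    simp [S]
  have hcompl : ((S ∪ A)ᶜ)ᶜ = S ∪ A := compl_compl _
  refine ⟨A, (S ∪ A)ᶜ, S \ A, ⟨hA, (hS.union hA).compl, hS.diff hA⟩, ⟨?_, ?_, ?_⟩, ?_, ?_, ?_⟩
  · exact Set.disjoint_left.2 fun x hx h => h (.inr hx)
  · exact Set.disjoint_sdiff_right
  · exact Set.disjoint_left.2 fun x hx h => hx (.inl h.1)
  · ext x
    simp only [Set.mem_union, Set.mem_compl_iff, Set.mem_sdiff, Set.mem_univ, iff_true]
    tauto
  · exact (Measure.restrict_mono (Set.compl_subset_compl.2 Set.subset_union_left)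
      le_rfl).absolutelyContinuous.trans hac
  · intro ν hν
    -- Since `ν ≪ μ`, all atoms of `ν` are atoms of `μ`.
    have hatom : ∀ T : Set (E n), T.Countable → Disjoint T A → ν T = 0 := by
      intro T hT hd
      refine (measure_null_iff_singleton hT).2 fun x hx => hν ?_
      exact not_not.1 fun h => Set.disjoint_left.1 hd hx (pos_iff_ne_zero.2 h)
    refine ⟨⟨fun h => ⟨A, hAc, h⟩, ?_⟩, ?_, ?_⟩
    · rintro ⟨T, hT, h⟩
      have h2 : Aᶜ ⊆ Tᶜ ∪ (T \ A) := fun x hx => by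
        by_cases hxT : x ∈ T
        · exact .inr ⟨hxT, hx⟩
        · exact .inl hxT
      exact measure_mono_null h2 (measure_union_null h
        (hatom _ (hT.mono Set.sdiff_subset) Set.disjoint_sdiff_left))
    · rw [hcompl]
      refine ⟨fun h T hT => ?_, fun h => h (measure_union_null hSv hAv)⟩
      have h1 : ν (T ∩ Sᶜ) = 0 := by
        refine hν ?_
        rw [← Measure.restrict_apply₀' hS.compl.nullMeasurableSet]
        exact hac hT
      refine measure_mono_null (t := (T ∩ Sᶜ) ∪ (S ∪ A)) (fun x hx => ?_)
        (measure_union_null h1 h)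
      by_cases hxS : x ∈ S
      · exact .inr (.inl hxS)
      · exact .inl ⟨hx, hxS⟩
    · constructor
      · intro h
        refine ⟨fun lam => ?_, ?_⟩
        · by_cases hl : lam ∈ A
          · exact measure_mono_null (Set.singleton_subset_iff.2 fun h' => h'.2 hl) h
          · exact hatom _ (Set.countable_singleton _) (Set.disjoint_singleton_left.2 hl)
        · exact ⟨(S \ A)ᶜ, (hS.diff hA).compl, h, by
            rw [compl_compl]; exact measure_mono_null Set.sdiff_subset hSv⟩
      · rintro ⟨h0, h1⟩
        have hνA : ν A = 0 := (measure_null_iff_singleton hAc).2 fun x _ => h0 x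
        -- Off `S` the measure `ν` is both absolutely continuous and singular, hence zero.
        have hνS : ν Sᶜ = 0 := by
          have h2 : ν.restrict Sᶜ ≪ volume := (hν.restrict Sᶜ).trans hac
          have h3 : ν.restrict Sᶜ ⟂ₘ volume := h1.restrict Sᶜ
          have := Measure.eq_zero_of_absolutelyContinuous_of_mutuallySingular h2 h3
          rwa [Measure.restrict_eq_zero] at this
        refine measure_mono_null (t := Sᶜ ∪ A) (fun x hx => ?_) (measure_union_null hνS hνA)
        by_cases hxA : x ∈ A
        · exact .inr hxA
        · exact .inl fun hxS => hx ⟨hxS, hxA⟩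

/-! ### Totality of the exponentials and the cyclic spectral model -/

theorem memLp_expChar (μ : Measure (E n)) [IsFiniteMeasure μ] (t : E n) :
    MemLp (fun lam => expChar lam t) 2 μ :=
  MemLp.of_bound (continuous_expChar_left t).aestronglyMeasurable 1 (by simp)

/-- The exponential `lam ↦ exp(i lam·t)` as a vector of `L²(μ)`. -/
def expLp (μ : Measure (E n)) [IsFiniteMeasure μ] (t : E n) : Lp ℂ 2 μ :=
  (memLp_expChar μ t).toLp _

theorem coeFn_expLp (μ : Measure (E n)) [IsFiniteMeasure μ] (t : E n) :
    expLp μ t =ᵐ[μ] fun lam => expChar lam t :=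
  MemLp.coeFn_toLp _

theorem inner_expLp (μ : Measure (E n)) [IsFiniteMeasure μ] (t : E n) (f : Lp ℂ 2 μ) :
    ⟪expLp μ t, f⟫_ℂ = ∫ lam, expChar lam (-t) * f lam ∂μ := by
  rw [L2.inner_def]
  refine integral_congr_ae ?_
  filter_upwards [coeFn_expLp μ t] with lam h
  rw [h, RCLike.inner_apply, conj_expChar, mul_comm]

theorem inner_expLp_expLp (μ : Measure (E n)) [IsFiniteMeasure μ] (s t : E n) :
    ⟪expLp μ s, expLp μ t⟫_ℂ = ∫ lam, expChar lam (t - s) ∂μ := by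
  rw [inner_expLp]
  refine integral_congr_ae ?_
  filter_upwards [coeFn_expLp μ t] with lam h
  rw [h, ← expChar_add, neg_add_eq_sub]

theorem integrable_Lp_two {μ : Measure (E n)} [IsFiniteMeasure μ] (f : Lp ℂ 2 μ) :
    Integrable f μ :=
  (Lp.memLp f).integrable (by norm_num)

/-- Totality of the exponentials: as `μ` is finite, `f` is integrable, and Fourier uniqueness
applies to `f dμ`. -/
theorem eq_zero_of_inner_expLp {μ : Measure (E n)} [IsFiniteMeasure μ] {f : Lp ℂ 2 μ}
    (h : ∀ t, ⟪expLp μ t, f⟫_ℂ = 0) : f = 0 := by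
  rw [Lp.eq_zero_iff_ae_eq_zero]
  refine ae_eq_zero_of_integral_expChar_mul (integrable_Lp_two f) fun t => ?_
  have := h (-t)
  rwa [inner_expLp, neg_neg] at this

theorem denseRange_linearCombination {K ι : Type*} [NormedAddCommGroup K] [InnerProductSpace ℂ K]
    [CompleteSpace K] {v : ι → K} (h : ∀ ξ, (∀ t, ⟪v t, ξ⟫_ℂ = 0) → ξ = 0) :
    DenseRange (Finsupp.linearCombination ℂ v) := by
  have h1 : (Submodule.span ℂ (Set.range v)).topologicalClosure = ⊤ := by
    rw [Submodule.topologicalClosure_eq_top_iff, Submodule.eq_bot_iff]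
    intro ξ hξ
    exact h ξ fun t => (Submodule.mem_orthogonal _ _).1 hξ _ (Submodule.subset_span ⟨t, rfl⟩)
  rw [← Finsupp.range_linearCombination] at h1
  rw [DenseRange, ← LinearMap.coe_range]
  exact Submodule.dense_iff_topologicalClosure_eq_top.2 h1

theorem inner_linearCombination {K ι : Type*} [NormedAddCommGroup K] [InnerProductSpace ℂ K]
    (v : ι → K) (x : ι →₀ ℂ) :
    ⟪Finsupp.linearCombination ℂ v x, Finsupp.linearCombination ℂ v x⟫_ℂ =
      ∑ s ∈ x.support, ∑ t ∈ x.support, conj (x s) * (x t * ⟪v s, v t⟫_ℂ) := by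
  simp only [Finsupp.linearCombination_apply, Finsupp.sum, sum_inner, inner_sum, inner_smul_left,
    inner_smul_right, Finset.mul_sum, mul_left_comm (x _) (conj _)]
  rw [Finset.sum_comm]

/-- Two total families with the same Gram matrix correspond under a unitary map. -/
theorem exists_linearIsometryEquiv_of_gram {K L ι : Type*}
    [NormedAddCommGroup K] [InnerProductSpace ℂ K] [CompleteSpace K]
    [NormedAddCommGroup L] [InnerProductSpace ℂ L] [CompleteSpace L] {v : ι → K} {w : ι → L}
    (hv : ∀ ξ, (∀ t, ⟪v t, ξ⟫_ℂ = 0) → ξ = 0) (hw : ∀ ξ, (∀ t, ⟪w t, ξ⟫_ℂ = 0) → ξ = 0)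
    (hvw : ∀ s t, ⟪v s, v t⟫_ℂ = ⟪w s, w t⟫_ℂ) :
    ∃ Φ : K ≃ₗᵢ[ℂ] L, ∀ t, Φ (v t) = w t := by
  -- Both norms are the same expression in the Gram matrix, so matching coefficients is isometric
  -- and extends from the dense spans.
  have hnorm : ∀ x, ‖Finsupp.linearCombination ℂ w (LinearEquiv.refl ℂ (ι →₀ ℂ) x)‖ =
      ‖Finsupp.linearCombination ℂ v x‖ := fun x => by
    rw [← sq_eq_sq₀ (norm_nonneg _) (norm_nonneg _), ← inner_self_eq_norm_sq (𝕜 := ℂ),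
      ← inner_self_eq_norm_sq (𝕜 := ℂ), inner_linearCombination, LinearEquiv.refl_apply,
      inner_linearCombination]
    simp only [hvw]
  refine ⟨(LinearEquiv.refl ℂ (ι →₀ ℂ)).extendOfIsometry _ _ (denseRange_linearCombination hv)
    (denseRange_linearCombination hw) hnorm, fun t => ?_⟩
  have h := LinearEquiv.extendOfIsometry_eq _ _ _ (denseRange_linearCombination hv)
    (denseRange_linearCombination hw) hnorm (Finsupp.single t 1)
  simpa using h

theorem UnitaryRep.inner_apply {H : Type*} [NormedAddCommGroup H] [InnerProductSpace ℂ H]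
    (U : UnitaryRep n H) (s t : E n) (ξ η : H) :
    ⟪U.toFun s ξ, U.toFun t η⟫_ℂ = ⟪ξ, U.toFun (t - s) η⟫_ℂ := by
  rw [← (U.toFun s).inner_map_map ξ, ← U.map_add, add_sub_cancel]

section Cyclic

variable {H : Type*} [NormedAddCommGroup H] [InnerProductSpace ℂ H] [CompleteSpace H]

/-- A representation with cyclic vector `v₀` and spectral measure `μ` is multiplication by the
exponentials on `L²(μ)`. -/
theorem UnitaryRep.exists_spectral_model (U : UnitaryRep n H) {v₀ : H} {μ : Measure (E n)}
    [IsFiniteMeasure μ] (hcyc : ∀ ξ, (∀ t, ⟪U.toFun t v₀, ξ⟫_ℂ = 0) → ξ = 0)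
    (hext : ∀ t, ⟪v₀, U.toFun t v₀⟫_ℂ = ∫ lam, expChar lam t ∂μ) :
    ∃ Φ : H ≃ₗᵢ[ℂ] Lp ℂ 2 μ, (∀ t, Φ (U.toFun t v₀) = expLp μ t) ∧
      ∀ t ξ, (Φ (U.toFun t ξ) : E n → ℂ) =ᵐ[μ] fun lam => expChar lam t * Φ ξ lam := by
  obtain ⟨Φ, hΦ⟩ := exists_linearIsometryEquiv_of_gram (v := fun t => U.toFun t v₀)
    (w := expLp μ) hcyc (fun f => eq_zero_of_inner_expLp) (fun s t => by
      rw [U.inner_apply, hext, inner_expLp_expLp])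
  refine ⟨Φ, hΦ, fun t ξ => ?_⟩
  have hi := integrable_expChar_mul (integrable_Lp_two (Φ ξ)) t
  -- The two sides are compared through their inner products with all exponentials. Pulled back by
  -- `Φ`, these become ⟨U(-s)v₀, U(t)ξ⟩ and ⟨U(-(s+t))v₀, ξ⟩, which agree by unitarity.
  have h := ae_eq_zero_of_integral_expChar_mul (μ := μ)
    (h := fun lam => Φ (U.toFun t ξ) lam - expChar lam t * Φ ξ lam)
    ((integrable_Lp_two _).sub hi) (fun s => by
      simp only [mul_sub]
      rw [integral_sub (integrable_expChar_mul (integrable_Lp_two _) s)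
        (integrable_expChar_mul hi s), sub_eq_zero]
      have h1 := inner_expLp μ (-s) (Φ (U.toFun t ξ))
      have h2 := inner_expLp μ (-(s + t)) (Φ ξ)
      rw [neg_neg, ← hΦ, Φ.inner_map_map] at h1 h2
      rw [← (U.toFun t).inner_map_map, ← U.map_add, neg_add_rev, add_neg_cancel_left] at h2
      rw [← h1, h2]
      simp only [expChar_add, mul_assoc])
  filter_upwards [h] with lam hlam
  exact sub_eq_zero.1 hlam

end Cyclic

/-! ### Transforms of f dμ and pairings with test functions -/

theorem continuous_measureInvFourier {μ : Measure (E n)} {f : E n → ℂ} (hf : Integrable f μ) :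
    Continuous (measureInvFourier μ f) := by
  refine continuous_of_dominated (bound := fun lam => ‖f lam‖)
    (fun x => (integrable_expChar_mul hf x).aestronglyMeasurable) (fun x => ?_) hf.norm ?_
  · exact .of_forall fun lam => by simp
  · exact .of_forall fun lam => (continuous_expChar_right lam).mul continuous_const

theorem measureInvFourier_congr {μ : Measure (E n)} {f g : E n → ℂ} (h : f =ᵐ[μ] g) :
    measureInvFourier μ f = measureInvFourier μ g := by
  funext x
  refine integral_congr_ae ?_
  filter_upwards [h] with lam hlam
  rw [hlam]

theorem measureInvFourier_eq_inner {μ : Measure (E n)} [IsFiniteMeasure μ] (f : Lp ℂ 2 μ)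
    (x : E n) : measureInvFourier μ f x = ⟪expLp μ (-x), f⟫_ℂ := by
  rw [inner_expLp, neg_neg]
  rfl

/-- The Riemann–Lebesgue lemma for `f dμ`, where `μ` is absolutely continuous off the zero set
of `f`. -/
theorem tendsto_measureInvFourier_cocompact {μ : Measure (E n)} [IsFiniteMeasure μ]
    {B : Set (E n)} (hB : MeasurableSet B) (hac : μ.restrict B ≪ volume) {f : E n → ℂ}
    (hf0 : ∀ᵐ lam ∂μ, lam ∈ Bᶜ → f lam = 0) :
    Tendsto (measureInvFourier μ f) (cocompact (E n)) (𝓝 0) := by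
  -- On `B`, `f dμ` is the Radon–Nikodym density times `f` against Lebesgue measure. Integrability
  -- of `f` is not needed: otherwise every integral takes the default value 0.
  have h := tendsto_integral_expChar_mul_cocompact
    (fun lam => ((((μ.restrict B).rnDeriv volume lam).toReal : ℝ) : ℂ) * f lam)
  refine h.congr fun x => ?_
  have h1 : measureInvFourier μ f x = ∫ lam in B, expChar lam x * f lam ∂μ := by
    rw [measureInvFourier, ← integral_indicator hB]
    refine integral_congr_ae ?_
    filter_upwards [hf0] with lam hlam
    by_cases hl : lam ∈ B
    · rw [Set.indicator_of_mem hl]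
    · rw [Set.indicator_of_notMem hl, hlam hl, mul_zero]
  rw [h1, ← integral_rnDeriv_smul hac]
  refine integral_congr_ae (.of_forall fun lam => ?_)
  simp only [Complex.real_smul]
  ring

section TestFunction

variable {Ω : Set (E n)} {φ : E n → ℂ}

theorem IsCc.integrable (hφ : IsCc Ω φ) : Integrable φ :=
  hφ.continuous.integrable_of_hasCompactSupport hφ.hasCompactSupport

theorem IsCc.eq_zero (hφ : IsCc Ω φ) {x : E n} (hx : x ∉ Ω) : φ x = 0 :=
  image_eq_zero_of_notMem_tsupport fun h => hx (hφ.tsupport_subset h)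

theorem continuous_fourierHat (hφ : Integrable φ) : Continuous (fourierHat φ) := by
  refine continuous_of_dominated (bound := fun x => ‖φ x‖) (fun lam => ?_) (fun lam => ?_)
    hφ.norm ?_
  · exact ((continuous_expChar_right lam).star).aestronglyMeasurable.mul hφ.aestronglyMeasurable
  · exact .of_forall fun x => by simp
  · exact .of_forall fun x => ((continuous_expChar_left x).star).mul continuous_const

theorem memLp_fourierHat (μ : Measure (E n)) [IsFiniteMeasure μ] (hφ : Integrable φ) :
    MemLp (fourierHat φ) 2 μ := by
  refine MemLp.of_bound (continuous_fourierHat hφ).aestronglyMeasurable (∫ x, ‖φ x‖)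
    (.of_forall fun lam => ?_)
  refine (norm_integral_le_integral_norm _).trans_eq ?_
  simp

/-- Fubini, justified because the exponential is bounded and g ⊗ φ is integrable for the product
measure. -/
theorem integral_mul_fourierHat {μ : Measure (E n)} [IsFiniteMeasure μ] (hφ : Integrable φ)
    {g : E n → ℂ} (hg : Integrable g μ) :
    ∫ lam, g lam * fourierHat φ lam ∂μ =
      ∫ y, (∫ lam, g lam * conj (expChar lam y) ∂μ) * φ y := by
  simp only [fourierHat, ← integral_const_mul, ← integral_mul_const]
  rw [integral_integral_swap]
  · simp only [mul_assoc]
  · have h := (hg.mul_prod hφ).bdd_mul (c := 1)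
      (f := fun p : E n × E n => conj (expChar p.1 p.2))
      (continuous_expChar_uncurry.star).aestronglyMeasurable (.of_forall fun p => by simp)
    refine h.congr (.of_forall fun p => ?_)
    simp only [Function.uncurry]
    ring

theorem pairing_eq_integral (hΩ : MeasurableSet Ω) (hφ : IsCc Ω φ) {ξ : Ω → ℂ} {G : E n → ℂ}
    (h : ∀ x : Ω, ξ x = G x) : pairing ξ φ = ∫ x, conj (G x) * φ x := by
  rw [pairing, ← setIntegral_eq_integral_of_forall_compl_eq_zero (s := Ω)
    (fun x hx => by rw [hφ.eq_zero hx, mul_zero]), ← integral_subtype_comap hΩ]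
  simp only [h]

theorem pairing_eq_integral_mul_fourierHat (hΩ : MeasurableSet Ω) (hφ : IsCc Ω φ)
    {μ : Measure (E n)} [IsFiniteMeasure μ] {f : E n → ℂ} (hf : Integrable f μ) {ξ : Ω → ℂ}
    (h : ∀ x : Ω, ξ x = measureInvFourier μ f x) :
    pairing ξ φ = ∫ lam, conj (f lam) * fourierHat φ lam ∂μ := by
  have hconj : Integrable (fun lam => conj (f lam)) μ :=
    (Complex.conjCLE : ℂ →L[ℝ] ℂ).integrable_comp hf
  rw [pairing_eq_integral hΩ hφ h, integral_mul_fourierHat hφ.integrable hconj]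
  refine integral_congr_ae (.of_forall fun x => ?_)
  simp only [measureInvFourier]
  rw [← integral_conj]
  simp only [map_mul, mul_comm]

end TestFunction

/-! ### The spectral model of ℋ_F, its atoms and its absolutely continuous part -/

namespace ContPosDef

variable {Ω : Set (E n)} {F : ContPosDef Ω} {μ : Measure (E n)} {U : UnitaryRep n F.HF}
  {v₀ : F.HF}

theorem inner_kernelVec (F : ContPosDef Ω) (x : Ω) (ξ : F.HF) : ⟪F.kernelVec x, ξ⟫_ℂ = ξ x := by
  rw [kernelVec, RKHS.kerFun_inner]
  simp

/-- At t = -x the orbit passes through F_x, so orthogonality to it forces ξ(x) = ⟨F_x, ξ⟩ = 0. -/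
theorem Corresponds.cyclic (hU : F.Corresponds μ U v₀) (ξ : F.HF)
    (h : ∀ t, ⟪U.toFun t v₀, ξ⟫_ℂ = 0) : ξ = 0 := by
  refine RKHS.ext fun x => ?_
  rw [← F.inner_kernelVec, ← hU.translate, h, RKHS.coe_zero]
  rfl

/-- A spectral model of `ℋ_F`: a unitary map onto `L²(μ)` that turns `U` into multiplication by
the exponentials. -/
structure IsSpectralModel [IsFiniteMeasure μ] (U : UnitaryRep n F.HF) (v₀ : F.HF)
    (Φ : F.HF ≃ₗᵢ[ℂ] Lp ℂ 2 μ) : Prop where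
  orbit : ∀ t, Φ (U.toFun t v₀) = expLp μ t
  unitary : ∀ t ξ, (Φ (U.toFun t ξ) : E n → ℂ) =ᵐ[μ] fun lam => expChar lam t * Φ ξ lam

theorem Corresponds.exists_spectralModel [IsFiniteMeasure μ] (hU : F.Corresponds μ U v₀) :
    ∃ Φ : F.HF ≃ₗᵢ[ℂ] Lp ℂ 2 μ, IsSpectralModel U v₀ Φ := by
  obtain ⟨Φ, h1, h2⟩ := U.exists_spectral_model hU.cyclic hU.extension
  exact ⟨Φ, h1, h2⟩

namespace IsSpectralModel

variable [IsFiniteMeasure μ] {Φ : F.HF ≃ₗᵢ[ℂ] Lp ℂ 2 μ}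

theorem apply_kernelVec (hΦ : IsSpectralModel U v₀ Φ) (hU : F.Corresponds μ U v₀) (x : Ω) :
    Φ (F.kernelVec x) = expLp μ (-(x : E n)) := by
  rw [← hU.translate, hΦ.orbit]

/-- The reproducing property transported to L²(μ), where F_x becomes the exponential at -x. -/
theorem apply_eq_measureInvFourier (hΦ : IsSpectralModel U v₀ Φ) (hU : F.Corresponds μ U v₀)
    (ξ : F.HF) (x : Ω) : ξ x = measureInvFourier μ (Φ ξ) x := by
  rw [measureInvFourier_eq_inner, ← hΦ.apply_kernelVec hU, Φ.inner_map_map, F.inner_kernelVec]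

theorem scalarMeasure_absolutelyContinuous {P : PVM n F.HF} (hΦ : IsSpectralModel U v₀ Φ)
    (hP : P.Represents U) (ξ : F.HF) : P.scalarMeasure ξ ≪ μ := by
  rw [hP.unique (represents_multiplicationPVM Φ hΦ.unitary), scalarMeasure_multiplicationPVM]
  exact withDensity_absolutelyContinuous _ _

/-- The `μ`-extensions of `ξ` come from a unique class in `L²(μ)`. -/
theorem isMuExtension_unique (hΦ : IsSpectralModel U v₀ Φ) (hU : F.Corresponds μ U v₀)
    {ξ : F.HF} {ξt : E n → ℂ} (h : IsMuExtension μ (fun x : Ω => ξ x) ξt) :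
    ξt = measureInvFourier μ (Φ ξ) := by
  obtain ⟨g, hg, rfl, hx⟩ := h
  have hg' : measureInvFourier μ (hg.toLp g) = measureInvFourier μ g :=
    measureInvFourier_congr hg.coeFn_toLp
  -- Both vectors restrict to the same function on Ω, and this determines an element of ℋ_F.
  have : ξ = Φ.symm (hg.toLp g) := by
    refine RKHS.ext fun x => ?_
    rw [← show _ = ξ x from hx x, hΦ.apply_eq_measureInvFourier hU, Φ.apply_symm_apply, hg']
  rw [this, Φ.apply_symm_apply, hg']

theorem ae_eq_zero_of_mem_carried {P : PVM n F.HF} (hΦ : IsSpectralModel U v₀ Φ)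
    (hP : P.Represents U) {B : Set (E n)} (hB : MeasurableSet B) {ξ : F.HF}
    (hξ : ξ ∈ P.carried B) : ∀ᵐ lam ∂μ, lam ∈ Bᶜ → Φ ξ lam = 0 := by
  rw [hP.unique (represents_multiplicationPVM Φ hΦ.unitary)] at hξ
  have h0 : indicatorOp μ Bᶜ hB.compl (Φ ξ) = 0 := by
    rw [← map_multiplicationPVM, show (multiplicationPVM Φ).toFun Bᶜ ξ = 0 from hξ, map_zero]
  filter_upwards [indicatorOp_coeFn μ hB.compl (Φ ξ), Lp.coeFn_zero ℂ 2 μ] with lam h1 h2 hl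
  rw [h0, h2, Set.indicator_of_mem hl] at h1
  exact h1.symm

/-- In the model F_φ is the class of φ^. After Fubini the inner integral is the transform of `μ` at
x - y, which equals F(x - y) because φ restricts `y` to Ω. -/
theorem isSmeared (hΦ : IsSpectralModel U v₀ Φ) (hU : F.Corresponds μ U v₀) (hμ : μ ∈ F.Ext)
    (hΩ : MeasurableSet Ω) {φ : E n → ℂ} (hφ : IsCc Ω φ) :
    F.IsSmeared φ (Φ.symm ((memLp_fourierHat μ hφ.integrable).toLp _)) := by
  intro x
  rw [hΦ.apply_eq_measureInvFourier hU, Φ.apply_symm_apply,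
    measureInvFourier_congr (MemLp.coeFn_toLp _), measureInvFourier,
    integral_mul_fourierHat hφ.integrable
      ((memLp_expChar μ (x : E n)).integrable (by norm_num)),
    ← setIntegral_eq_integral_of_forall_compl_eq_zero (s := Ω)
      (fun y hy => by rw [hφ.eq_zero hy, mul_zero])]
  refine setIntegral_congr_fun hΩ fun y hy => ?_
  simp only [conj_expChar, ← expChar_add, ← sub_eq_add_neg]
  rw [hμ.2 _ (Set.sub_mem_sub x.2 hy), mul_comm]

/-- The choice f = Φξ serves throughout. Only the decay at infinity depends on ξ lying in the
absolutely continuous part. -/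
theorem absContCase (hΦ : IsSpectralModel U v₀ Φ) (hU : F.Corresponds μ U v₀) (hμ : μ ∈ F.Ext)
    (hΩ : MeasurableSet Ω) {P : PVM n F.HF} (hP : P.Represents U) {B : Set (E n)}
    (hB : MeasurableSet B) (hac : μ.restrict B ≪ volume) : F.AbsContCase μ (P.carried B) := by
  intro ξ hξ
  have hcont := continuous_measureInvFourier (integrable_Lp_two (Φ ξ))
  have heval := hΦ.apply_eq_measureInvFourier hU ξ
  refine ⟨?_, fun φ hφ => ⟨_, hΦ.isSmeared hU hμ hΩ hφ, ?_⟩, ⟨Φ ξ, Lp.memLp _, fun φ hφ =>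
    pairing_eq_integral_mul_fourierHat hΩ hφ (integrable_Lp_two _) heval, heval,
    ⟨Φ ξ, Lp.memLp _, rfl, fun x => (heval x).symm⟩⟩, fun ξt h => ?_⟩
  · exact (hcont.comp continuous_subtype_val).congr fun x => (heval x).symm
  · rw [pairing_eq_integral_mul_fourierHat hΩ hφ (integrable_Lp_two _) heval,
      ← Φ.inner_map_map, Φ.apply_symm_apply, L2.inner_def]
    refine integral_congr_ae ?_
    filter_upwards [(memLp_fourierHat μ hφ.integrable).coeFn_toLp] with lam hlam
    rw [hlam, RCLike.inner_apply, mul_comm]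
  · rw [hΦ.isMuExtension_unique hU h]
    exact ⟨hcont, tendsto_measureInvFourier_cocompact hB hac
      (hΦ.ae_eq_zero_of_mem_carried hP hB hξ)⟩

theorem atomicCase (hΦ : IsSpectralModel U v₀ Φ) (hU : F.Corresponds μ U v₀)
    (hne : Ω.Nonempty) {P : PVM n F.HF} (hP : P.Represents U) : F.AtomicCase P := by
  intro lam hlam
  have hPΦ := hP.unique (represents_multiplicationPVM Φ hΦ.unitary)
  have hm : MeasurableSet ({lam} : Set (E n)) := measurableSet_singleton lam
  have hμ0 : μ {lam} ≠ 0 := by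
    intro h0
    refine hlam (ContinuousLinearMap.ext fun ξ => ?_)
    exact (P.apply_eq_zero_iff hm ξ).2 (hΦ.scalarMeasure_absolutelyContinuous hP ξ h0)
  have hr : (μ.real {lam} : ℂ) ≠ 0 := by
    exact_mod_cast (measureReal_ne_zero_iff (measure_ne_top _ _)).2 hμ0
  have hPapply : ∀ ξ : F.HF, (Φ (P.toFun {lam} ξ) : E n → ℂ) =ᵐ[μ]
      ({lam} : Set (E n)).indicator (Φ ξ) := by
    intro ξ
    rw [hPΦ, map_multiplicationPVM Φ hm]
    exact indicatorOp_coeFn μ hm (Φ ξ)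
  -- The model vector of P({lam})ξ is supported at lam, so its transform integral has a single term.
  have hval : ∀ (ξ : F.HF) (x : Ω),
      P.toFun {lam} ξ x = (μ.real {lam} : ℂ) * Φ ξ lam * expChar lam x := by
    intro ξ x
    rw [hΦ.apply_eq_measureInvFourier hU, measureInvFourier_congr (hPapply ξ), measureInvFourier]
    have : (fun l => expChar l (x : E n) * ({lam} : Set (E n)).indicator (Φ ξ) l) =
        ({lam} : Set (E n)).indicator fun l => expChar l (x : E n) * Φ ξ l := by
      funext l
      by_cases hl : l ∈ ({lam} : Set (E n)) <;> simp [hl]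
    rw [this, integral_indicator hm, integral_singleton, Complex.real_smul]
    ring
  obtain ⟨ξ, hξ⟩ : ∃ ξ, P.toFun {lam} ξ ≠ 0 := by
    by_contra! h
    exact hlam (ContinuousLinearMap.ext h)
  have hξ0 : Φ ξ lam ≠ 0 := by
    intro h0
    refine hξ (RKHS.ext fun x => ?_)
    rw [hval, h0, mul_zero, zero_mul, RKHS.coe_zero]
    rfl
  -- The scalar cancels the factor in `hval`, so that `e` is exactly e_lam on Ω.
  set e : F.HF := ((μ.real {lam} : ℂ) * Φ ξ lam)⁻¹ • P.toFun {lam} ξ with he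
  have hex : ∀ x : Ω, e x = expChar lam x := by
    intro x
    rw [he, RKHS.coe_smul, Pi.smul_apply, hval, smul_eq_mul,
      inv_mul_cancel_left₀ (mul_ne_zero hr hξ0)]
  have hspan : (P.toFun {lam}).range = Submodule.span ℂ {e} := by
    refine le_antisymm ?_ ?_
    · rintro _ ⟨η, rfl⟩
      refine Submodule.mem_span_singleton.2 ⟨(μ.real {lam} : ℂ) * Φ η lam, ?_⟩
      refine RKHS.ext fun x => ?_
      rw [RKHS.coe_smul, Pi.smul_apply, hex, smul_eq_mul]
      exact (hval η x).symm
    · rw [Submodule.span_singleton_le_iff_mem]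
      exact Submodule.smul_mem _ _ ⟨ξ, rfl⟩
  refine ⟨?_, e, hex, hspan⟩
  rw [hspan]
  -- `e` is nonzero because e_lam has modulus 1 at some point of the nonempty set Ω.
  refine finrank_span_singleton fun h0 => ?_
  obtain ⟨x, hx⟩ := hne
  have h1 := hex ⟨x, hx⟩
  rw [h0, RKHS.coe_zero] at h1
  have h2 := norm_expChar lam x
  rw [← h1] at h2
  simp at h2

end IsSpectralModel

end ContPosDef

end LocalPD

end

open LocalPD in
theorem mainTheorem4 {n : ℕ} (hn : 1 ≤ n) {Ω : Set (E n)} (hΩ : IsOpen Ω) (hconn : IsConnected Ω)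
    (F : ContPosDef Ω) (μ : Measure (E n)) (hμ : μ ∈ F.Ext)
    (U : UnitaryRep n F.HF) (v₀ : F.HF) (hU : F.Corresponds μ U v₀) :
    (∃! P : PVM n F.HF, P.Represents U) ∧
    ∀ P : PVM n F.HF, P.Represents U →
      μ = P.scalarMeasure v₀ ∧
      (∃ Hatom Hac Hsing : Submodule ℂ F.HF,
        (PVM.Reduces Hatom U P ∧ PVM.Reduces Hac U P ∧ PVM.Reduces Hsing U P) ∧
        (Hatom ⟂ Hac ∧ Hatom ⟂ Hsing ∧ Hac ⟂ Hsing ∧ Hatom ⊔ Hac ⊔ Hsing = ⊤) ∧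
        (∀ ξ, ξ ∈ Hatom ↔ IsPurelyAtomic (P.scalarMeasure ξ)) ∧
        (∀ ξ, ξ ∈ Hac ↔ P.scalarMeasure ξ ≪ (volume : Measure (E n))) ∧
        (∀ ξ, ξ ∈ Hsing ↔ IsContinuousSingular (P.scalarMeasure ξ)) ∧
        F.AbsContCase μ Hac) ∧
      F.AtomicCase P := by
  have : IsFiniteMeasure μ := hμ.1
  obtain ⟨Φ, hΦ⟩ := hU.exists_spectralModel
  refine ⟨⟨multiplicationPVM Φ, represents_multiplicationPVM Φ hΦ.unitary,
    fun Q hQ => hQ.unique (represents_multiplicationPVM Φ hΦ.unitary)⟩, fun P hP => ⟨?_, ?_, ?_⟩⟩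
  · exact measure_ext_of_integral_expChar fun t => by rw [← hU.extension, hP]
  · obtain ⟨A, B, C, ⟨hA, hB, hC⟩, ⟨hAB, hAC, hBC⟩, huniv, hac, hchar⟩ :=
      exists_lebesgue_partition hn μ
    have hchar' := fun ξ => hchar _ (hΦ.scalarMeasure_absolutelyContinuous hP ξ)
    exact ⟨P.carried A, P.carried B, P.carried C,
      ⟨hP.reduces_carried hA, hP.reduces_carried hB, hP.reduces_carried hC⟩,
      ⟨P.carried_isOrtho hA hB hAB, P.carried_isOrtho hA hC hAC, P.carried_isOrtho hB hC hBC,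
        P.carried_sup_eq_top hA hB hC hAB (hAC.union_left hBC) huniv⟩,
      fun ξ => (P.mem_carried hA).trans (hchar' ξ).1,
      fun ξ => (P.mem_carried hB).trans (hchar' ξ).2.1,
      fun ξ => (P.mem_carried hC).trans (hchar' ξ).2.2,
      hΦ.absContCase hU hμ hΩ.measurableSet hP hB hac⟩
  · exact hΦ.atomicCase hU hconn.nonempty hP
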